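/- Let $\mathbb{D}=\{z\in\mathbb{C}:|z|<1\}$ and $dA=\frac{dx\,dy}{\pi}$. Let $0<p<\infty$ and let $\omega$ be a radial weight, that is, a nonnegative function on $\mathbb{D}$, integrable with respect to $dA$, with $\omega(z)=\omega(|z|)$ for all $z\in\mathbb{D}$. For $u=re^{i\theta}\in\mathbb{D}\setminus\{0\}$ put $$\Gamma(u)=\Big\{z\in\mathbb{D}:\ |\theta-\arg z|<\tfrac12\Big(1-\frac{|z|}{r}\Big)\Big\},$$ where the difference of the angles is measured modulo $2\pi$ (as its representative of least absolute value) and $0\in\Gamma(u)$, and for $f$ analytic in $\mathbb{D}$ put $N(f)(u)=\sup_{z\in\Gamma(u)}|f(z)|$. Then there exists a constant $C>0$ (depending only on $p$ and $\omega$) such that, for all analytic functions $f$ in $\mathbb{D}$, $$\|f\|_{A^p_\omega}^p\le\|N(f)\|_{L^p_\omega}^p\le C\,\|f\|_{A^p_\omega}^p,$$ where $\|f\|_{A^p_\omega}^p=\int_{\mathbb{D}}|f|^p\,\omega\,dA$ and $\|N(f)\|_{L^p_\omega}^p=\int_{\mathbb{D}}N(f)^p\,\omega\,dA$ take values in $[0,\infty]$.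 -/

import Mathlib

open Set MeasureTheory Filter
open scoped NNReal ENNReal

noncomputable section

/-- The open unit disc `𝔻` of the complex plane. -/
def unitDisc : Set ℂ := Metric.ball 0 1

/-- The normalized Lebesgue area measure `dA = dx dy / π` (on `ℂ`; it is integrated over the unit
disc below). -/
def areaMeasure : Measure ℂ := (ENNReal.ofReal Real.pi)⁻¹ • (volume : Measure ℂ)

/-- A radial weight: a nonnegative integrable function on the unit disc such that
`ω z = ω |z|` there. -/
structure IsRadialWeight (ω : ℂ → ℝ) : Prop where
  nonneg : ∀ z ∈ unitDisc, 0 ≤ ω z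
  integrableOn : IntegrableOn ω unitDisc areaMeasure
  radial : ∀ z ∈ unitDisc, ω z = ω ((‖z‖ : ℝ) : ℂ)

/-- `‖g‖_{L^p_ω}^p = ∫_𝔻 g^p ω dA` for a `[0, ∞]`-valued function `g` (the modulus of the
function whose norm is taken). The value `∞` means that the function is not in `L^p_ω`. -/
def weightedLpPow (p : ℝ) (ω : ℂ → ℝ) (g : ℂ → ℝ≥0∞) : ℝ≥0∞ :=
  ∫⁻ z in unitDisc, g z ^ p * ENNReal.ofReal (ω z) ∂areaMeasure

/-- `‖f‖_{A^p_ω}^p = ∫_𝔻 |f|^p ω dA`. -/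
def bergmanPow (p : ℝ) (ω : ℂ → ℝ) (f : ℂ → ℂ) : ℝ≥0∞ :=
  weightedLpPow p ω fun z => ‖f z‖ₑ

/-- The non-tangential approach region
`Γ(u) = {z ∈ 𝔻 : |θ - arg z| < (1 - |z| / r) / 2}` with vertex `u = r e^{iθ} ≠ 0`.
As `arg (z / u)` lies in `(-π, π]`, its absolute value is the distance of `θ` and `arg z`
modulo `2π`. The origin belongs to `Γ(u)`. The value at `u = 0` is irrelevant. -/
def approachRegion (u : ℂ) : Set ℂ :=
  {z | z ∈ unitDisc ∧ |(z / u).arg| < (1 / 2) * (1 - ‖z‖ / ‖u‖)}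

/-- The non-tangential maximal function `N(f)(u) = sup_{z ∈ Γ(u)} |f z|`. -/
def nonTangentialMax (f : ℂ → ℂ) (u : ℂ) : ℝ≥0∞ :=
  ⨆ z ∈ approachRegion u, ‖f z‖ₑ

/-- The set of vertices `u ≠ 0` whose approach region contains `z` is open. -/
theorem isOpen_tent (z : ℂ) : IsOpen {u : ℂ | u ≠ 0 ∧ z ∈ approachRegion u} := by
  rw [isOpen_iff_mem_nhds]
  rintro u ⟨hu, hz, hzu⟩
  have hc : ContinuousAt (fun w : ℂ => |(z / w).arg| - (1 / 2) * (1 - ‖z‖ / ‖w‖)) u := by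
    refine ContinuousAt.sub ?_ ?_
    · by_cases h0 : z = 0
      · simpa [h0] using continuousAt_const
      · have h1 : (fun w : ℂ => |(z / w).arg|) =ᶠ[nhds u]
            fun w => InnerProductGeometry.angle z w := by
          filter_upwards [isOpen_ne.mem_nhds hu] with w hw
          exact (Complex.angle_eq_abs_arg h0 hw).symm
        refine ContinuousAt.congr ?_ h1.symm
        exact (InnerProductGeometry.continuousAt_angle (x := (z, u)) h0 hu).comp
          (f := fun w : ℂ => (z, w)) (by fun_prop)
    · have : ‖u‖ ≠ 0 := norm_ne_zero_iff.2 hu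
      fun_prop (disch := assumption)
  have h2 := hc.eventually (gt_mem_nhds (sub_neg.2 hzu))
  filter_upwards [h2, isOpen_ne.mem_nhds hu] with w hw hw0
  exact ⟨hw0, hz, sub_neg.1 hw⟩

/-- The non-tangential maximal function is measurable, so its integral is a genuine one. -/
theorem measurable_nonTangentialMax (f : ℂ → ℂ) : Measurable (nonTangentialMax f) := by
  refine measurable_of_Ioi fun a => ?_
  have h : nonTangentialMax f ⁻¹' Ioi a =
      (⋃ z ∈ {z : ℂ | a < ‖f z‖ₑ}, {u : ℂ | u ≠ 0 ∧ z ∈ approachRegion u}) ∪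
        ({0} ∩ nonTangentialMax f ⁻¹' Ioi a) := by
    ext u
    by_cases hu : u = 0
    · simp [hu]
    · simp [hu, nonTangentialMax, lt_iSup_iff, and_comm]
  rw [h]
  refine MeasurableSet.union ?_ ?_
  · exact (isOpen_biUnion fun z _ => isOpen_tent z).measurableSet
  · exact ((finite_singleton (0 : ℂ)).subset inter_subset_left).measurableSet

end

noncomputable section

/-! The lower bound holds because every `u ≠ 0` is a radial limit of points of its own approach
region. For the upper bound, `ω dA` is rotation invariant, so averaging over rotations
(`setLIntegral_average_rotation`) reduces it to a nontangential maximal theorem on each circle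
centred at `0` (`lintegral_nonTangentialMax_le`).

On such a circle `|f|^q`, for every `q > 0`, is dominated by its Poisson integral
(`enorm_rpow_le_lintegral_poissonKernel`). Inside the approach region the Poisson kernel is at most
a constant times a Cauchy kernel centred at the vertex, of dyadic width
(`poissonKernel_le_of_mem_approach`). Hence `N(f)^q` is controlled by a countable supremum of Cauchy
means of `|f|^q`. With `q = p / 2`, an `L²` maximal inequality settles every `p > 0`.

That inequality (`lintegral_iSup_cauchyMean_sq_le`) needs no covering lemma. A measurable choice of
width turns the truncated supremum into a positive kernel operator `T`. The pointwise bound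
`cauchyKernel_mul_le` on products of kernels gives `TT* ≤ 4C (T + T*)` on nonnegative functions, and
Cauchy-Schwarz then bounds `T*`, hence `T`, on `L²`. -/

/-! ### Poisson sub-mean-value property of `|f|^q` -/

lemma one_sub_mul_re_nonneg {b z : ℂ} (hb : ‖b‖ ≤ 1) (hz : ‖z‖ ≤ 1) : 0 ≤ (1 - b * z).re := by
  have h1 : (b * z).re ≤ ‖b * z‖ := Complex.re_le_norm _
  have h2 : ‖b * z‖ ≤ 1 := by
    rw [norm_mul]; exact mul_le_one₀ hb (norm_nonneg _) hz
  simp only [Complex.sub_re, Complex.one_re]; linarith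

lemma one_sub_mul_re_pos {b z : ℂ} (hb : ‖b‖ ≤ 1) (hz : ‖z‖ < 1) : 0 < (1 - b * z).re := by
  have h1 : (b * z).re ≤ ‖b * z‖ := Complex.re_le_norm _
  have h2 : ‖b * z‖ < 1 := by
    rw [norm_mul]; nlinarith [norm_nonneg b, norm_nonneg z]
  simp only [Complex.sub_re, Complex.one_re]; linarith

/-- A real power of a linear factor without zeros in the open unit disc is holomorphic there and
continuous on the closure. -/
lemma diffContOnCl_one_sub_mul_cpow {b : ℂ} (hb : ‖b‖ ≤ 1) {q : ℝ} (hq : 0 < q) :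
    DiffContOnCl ℂ (fun z => (1 - b * z) ^ (q : ℂ)) (Metric.ball 0 1) := by
  refine ⟨fun z hz => ?_, fun z hz => ?_⟩
  · refine DifferentiableAt.differentiableWithinAt ?_
    refine DifferentiableAt.cpow (by fun_prop) (by fun_prop) (Or.inl ?_)
    exact one_sub_mul_re_pos hb (by simpa using hz)
  · rw [closure_ball _ one_ne_zero, mem_closedBall_zero_iff] at hz
    refine ContinuousAt.continuousWithinAt ?_
    have h0 := one_sub_mul_re_nonneg hb hz
    have key : ContinuousAt (fun x : ℂ => x ^ (q : ℂ)) (1 - b * z) := by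
      -- On the closed disc the factor stays in the closed right half-plane, which meets the
      -- complement of the slit plane only at `0`; continuity there uses `q > 0`.
      by_cases h : 1 - b * z = 0
      · rw [h]
        have h3 := Complex.continuousAt_cpow_zero_of_re_pos (z := (q : ℂ)) (by simpa using hq)
        exact h3.comp (f := fun x : ℂ => (x, (q : ℂ))) (by fun_prop)
      · refine continuousAt_cpow_const ?_
        rcases h0.lt_or_eq with h1 | h1
        · exact Or.inl h1
        · refine Or.inr fun h2 => h (Complex.ext h1.symm h2)
    exact key.comp (f := fun z : ℂ => 1 - b * z) (by fun_prop)

lemma norm_sub_eq_norm_one_sub_conj_mul {a z : ℂ} (hz : ‖z‖ = 1) :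
    ‖z - a‖ = ‖1 - (starRingEnd ℂ) a * z‖ := by
  have h : 1 - (starRingEnd ℂ) a * z = z * (starRingEnd ℂ) (z - a) := by
    rw [map_sub, mul_sub, Complex.mul_conj, Complex.normSq_eq_norm_sq, hz]
    push_cast; ring
  rw [h, norm_mul, hz, one_mul, Complex.norm_conj]

lemma norm_sub_le_norm_one_sub_conj_mul {a z : ℂ} (ha : ‖a‖ ≤ 1) (hz : ‖z‖ ≤ 1) :
    ‖z - a‖ ≤ ‖1 - (starRingEnd ℂ) a * z‖ := by
  rw [← sq_le_sq₀ (norm_nonneg _) (norm_nonneg _), ← Complex.normSq_eq_norm_sq,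
    ← Complex.normSq_eq_norm_sq]
  have h1 : Complex.normSq (1 - (starRingEnd ℂ) a * z) - Complex.normSq (z - a)
      = (1 - Complex.normSq a) * (1 - Complex.normSq z) := by
    simp [Complex.normSq_apply]; ring
  have h2 : Complex.normSq a ≤ 1 := by
    rw [Complex.normSq_eq_norm_sq]; exact pow_le_one₀ (norm_nonneg _) ha
  have h3 : Complex.normSq z ≤ 1 := by
    rw [Complex.normSq_eq_norm_sq]; exact pow_le_one₀ (norm_nonneg _) hz
  nlinarith

/-- A linear factor is dominated in the unit disc by one without zeros in the open disc, with
equality of moduli on the unit circle. -/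
lemma exists_linear_majorant (a : ℂ) : ∃ c b : ℂ, ‖b‖ ≤ 1 ∧
    (∀ z ∈ Metric.ball (0 : ℂ) 1, ‖z - a‖ ≤ ‖c * (1 - b * z)‖) ∧
    ∀ z ∈ Metric.sphere (0 : ℂ) 1, ‖c * (1 - b * z)‖ = ‖z - a‖ := by
  by_cases ha : ‖a‖ ≤ 1
  · refine ⟨1, (starRingEnd ℂ) a, by simpa using ha, fun z hz => ?_, fun z hz => ?_⟩
    · rw [one_mul]
      exact norm_sub_le_norm_one_sub_conj_mul ha (by simpa using (mem_ball_zero_iff.1 hz).le)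
    · rw [one_mul]
      exact (norm_sub_eq_norm_one_sub_conj_mul (by simpa using hz)).symm
  · have ha0 : a ≠ 0 := by rintro rfl; simp at ha
    have h (z : ℂ) : ‖-a * (1 - a⁻¹ * z)‖ = ‖z - a‖ := by
      congr 1; field_simp; ring
    refine ⟨-a, a⁻¹, ?_, fun z _ => (h z).ge, fun z _ => h z⟩
    rw [norm_inv]; exact inv_le_one_of_one_le₀ (not_le.1 ha).le

/-- Roots in the closed disc are reflected across the circle, so each linear factor becomes one with
positive real part in the open disc. Its principal `q`-th power is then holomorphic, and these
powers are multiplied over the roots. -/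
lemma exists_diffContOnCl_majorant (P : Polynomial ℂ) {q : ℝ} (hq : 0 < q) :
    ∃ H : ℂ → ℂ, DiffContOnCl ℂ H (Metric.ball 0 1) ∧
      (∀ z ∈ Metric.ball (0 : ℂ) 1, ‖P.eval z‖ ^ q ≤ ‖H z‖) ∧
      ∀ z ∈ Metric.sphere (0 : ℂ) 1, ‖H z‖ = ‖P.eval z‖ ^ q := by
  have key : ∀ s : Multiset ℂ, ∃ H : ℂ → ℂ, DiffContOnCl ℂ H (Metric.ball 0 1) ∧
      (∀ z ∈ Metric.ball (0 : ℂ) 1, ‖(s.map fun a => z - a).prod‖ ^ q ≤ ‖H z‖) ∧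
      ∀ z ∈ Metric.sphere (0 : ℂ) 1, ‖H z‖ = ‖(s.map fun a => z - a).prod‖ ^ q := by
    intro s
    induction s using Multiset.induction_on with
    | empty => exact ⟨fun _ => 1, diffContOnCl_const, by simp, by simp⟩
    | cons a s ih =>
      obtain ⟨H, hH, h1, h2⟩ := ih
      obtain ⟨c, b, hb, h3, h4⟩ := exists_linear_majorant a
      have hn (z : ℂ) : ‖(((‖c‖ ^ q : ℝ) : ℂ) * (1 - b * z) ^ (q : ℂ)) * H z‖ =
          ‖c * (1 - b * z)‖ ^ q * ‖H z‖ := by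
        rw [norm_mul, norm_mul, Complex.norm_cpow_real, Complex.norm_real, Real.norm_eq_abs,
          abs_of_nonneg (by positivity), norm_mul, Real.mul_rpow (norm_nonneg _) (norm_nonneg _)]
      refine ⟨fun z => (((‖c‖ ^ q : ℝ) : ℂ) * (1 - b * z) ^ (q : ℂ)) * H z, ?_, fun z hz => ?_,
        fun z hz => ?_⟩
      · exact ((diffContOnCl_one_sub_mul_cpow hb hq).const_smul ((‖c‖ ^ q : ℝ) : ℂ)).smul hH
      · rw [hn, Multiset.map_cons, Multiset.prod_cons, norm_mul,
          Real.mul_rpow (norm_nonneg _) (norm_nonneg _)]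
        exact mul_le_mul (Real.rpow_le_rpow (norm_nonneg _) (h3 z hz) hq.le) (h1 z hz)
          (by positivity) (by positivity)
      · rw [hn, h4 z hz, h2 z hz, Multiset.map_cons, Multiset.prod_cons, norm_mul,
          Real.mul_rpow (norm_nonneg _) (norm_nonneg _)]
  obtain ⟨H, hH, h1, h2⟩ := key P.roots
  have hP (z : ℂ) : ‖P.eval z‖ ^ q =
      ‖P.leadingCoeff‖ ^ q * ‖(P.roots.map fun a => z - a).prod‖ ^ q := by
    rw [(IsAlgClosed.splits P).eval_eq_prod_roots, norm_mul,
      Real.mul_rpow (norm_nonneg _) (norm_nonneg _)]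
  have hn (z : ℂ) : ‖((‖P.leadingCoeff‖ ^ q : ℝ) : ℂ) * H z‖ = ‖P.leadingCoeff‖ ^ q * ‖H z‖ := by
    rw [norm_mul, Complex.norm_real, Real.norm_eq_abs, abs_of_nonneg (by positivity)]
  refine ⟨fun z => ((‖P.leadingCoeff‖ ^ q : ℝ) : ℂ) * H z,
    hH.const_smul ((‖P.leadingCoeff‖ ^ q : ℝ) : ℂ), fun z hz => ?_,
    fun z hz => ?_⟩
  · rw [hn, hP]; gcongr; exact h1 z hz
  · rw [hn, hP, h2 z hz]

lemma poissonKernel_nonneg_of_mem {w z : ℂ} (hw : w ∈ Metric.ball (0 : ℂ) 1)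
    (hz : z ∈ Metric.sphere (0 : ℂ) 1) : 0 ≤ poissonKernel 0 w z := by
  have h1 : ‖w‖ < 1 := by simpa using hw
  have h2 : ‖z‖ = 1 := by simpa using hz
  rw [poissonKernel_def, sub_zero, sub_zero, h2]
  have : ‖w‖ ^ 2 ≤ 1 := pow_le_one₀ (norm_nonneg _) h1.le
  exact div_nonneg (by linarith) (by positivity)

lemma continuous_poissonKernel_circleMap {w : ℂ} (hw : w ∈ Metric.ball (0 : ℂ) 1) :
    Continuous fun t : ℝ => poissonKernel 0 w (circleMap 0 1 t) := by
  have h : ∀ t : ℝ, ‖circleMap 0 1 t - w‖ ^ 2 ≠ 0 := fun t =>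
    pow_ne_zero _ (norm_ne_zero_iff.2 (sub_ne_zero.2 (circleMap_ne_mem_ball hw t)))
  simp only [poissonKernel_def, sub_zero]
  fun_prop (disch := exact h)

/-- The Poisson formula for the holomorphic majorant and the triangle inequality: the majorant only
gains at `w` and changes nothing on the circle. -/
lemma norm_eval_rpow_le_integral (P : Polynomial ℂ) {q : ℝ} (hq : 0 < q) {w : ℂ}
    (hw : w ∈ Metric.ball (0 : ℂ) 1) :
    ‖P.eval w‖ ^ q ≤ (2 * Real.pi)⁻¹ * ∫ t in (0 : ℝ)..2 * Real.pi,
      poissonKernel 0 w (circleMap 0 1 t) * ‖P.eval (circleMap 0 1 t)‖ ^ q := by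
  obtain ⟨H, hH, h1, h2⟩ := exists_diffContOnCl_majorant P hq
  refine (h1 w hw).trans ?_
  rw [← hH.circleAverage_poissonKernel_smul hw, Real.circleAverage_def, norm_smul,
    Real.norm_eq_abs, abs_of_pos (by positivity)]
  gcongr
  refine (intervalIntegral.norm_integral_le_integral_norm Real.two_pi_pos.le).trans_eq ?_
  refine intervalIntegral.integral_congr fun t _ => ?_
  have ht : circleMap 0 1 t ∈ Metric.sphere (0 : ℂ) 1 := circleMap_mem_sphere _ zero_le_one _
  simp only [Pi.smul_apply', norm_smul, h2 _ ht, Real.norm_eq_abs,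
    abs_of_nonneg (poissonKernel_nonneg_of_mem hw ht)]

/-- Taylor polynomials of `f` converge uniformly on a disc of radius between `‖u‖` and `1`; the
powers of `u` are absorbed into the coefficients. -/
lemma exists_polynomial_tendstoUniformlyOn {f : ℂ → ℂ} (hf : AnalyticOnNhd ℂ f unitDisc) {u : ℂ}
    (hu : ‖u‖ < 1) : ∃ P : ℕ → Polynomial ℂ,
      TendstoUniformlyOn (fun n z => (P n).eval z) (fun z => f (u * z)) atTop
        (Metric.closedBall 0 1) := by
  obtain ⟨r, hur, hr1⟩ := exists_between hu
  obtain ⟨s, hrs, hs1⟩ := exists_between hr1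
  have hr0 : 0 < r := (norm_nonneg u).trans_lt hur
  lift r to ℝ≥0 using hr0.le
  lift s to ℝ≥0 using (hr0.trans hrs).le
  have hfs : DifferentiableOn ℂ f (Metric.closedBall 0 s) := fun z hz =>
    (hf z (by
      rw [unitDisc, mem_ball_zero_iff]
      exact (mem_closedBall_zero_iff.1 hz).trans_lt hs1)).differentiableAt.differentiableWithinAt
  have hp := hfs.hasFPowerSeriesOnBall (hr0.trans hrs)
  have ht := hp.tendstoUniformlyOn (r' := r) (by exact_mod_cast hrs)
  refine ⟨fun n => ∑ k ∈ Finset.range n,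
    Polynomial.monomial k (u ^ k * (cauchyPowerSeries f 0 s).coeff k), ?_⟩
  have hmaps : MapsTo (fun z => u * z) (Metric.closedBall (0 : ℂ) 1) (Metric.ball 0 r) := by
    intro z hz
    rw [mem_closedBall_zero_iff] at hz
    rw [mem_ball_zero_iff, norm_mul]
    nlinarith [norm_nonneg u]
  have ht2 := (ht.comp (fun z => u * z)).mono hmaps
  refine (ht2.congr (Eventually.of_forall fun n z _ => ?_)).congr_right fun z _ => ?_
  · simp only [Function.comp_apply, FormalMultilinearSeries.partialSum,
      FormalMultilinearSeries.apply_eq_pow_smul_coeff, Polynomial.eval_finsetSum,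
      Polynomial.eval_monomial, smul_eq_mul]
    refine Finset.sum_congr rfl fun k _ => ?_
    ring
  · simp

/-- Sub-mean-value property of `|f|^q` with respect to the Poisson kernel. -/
lemma norm_rpow_le_integral_poissonKernel {f : ℂ → ℂ} (hf : AnalyticOnNhd ℂ f unitDisc) {u w : ℂ}
    (hu : ‖u‖ < 1) (hw : w ∈ Metric.ball (0 : ℂ) 1) {q : ℝ} (hq : 0 < q) :
    ‖f (u * w)‖ ^ q ≤ (2 * Real.pi)⁻¹ * ∫ t in (0 : ℝ)..2 * Real.pi,
      poissonKernel 0 w (circleMap 0 1 t) * ‖f (u * circleMap 0 1 t)‖ ^ q := by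
  obtain ⟨P, hP⟩ := exists_polynomial_tendstoUniformlyOn hf hu
  have hpt {z : ℂ} (hz : z ∈ Metric.closedBall (0 : ℂ) 1) :
      Tendsto (fun n => ‖(P n).eval z‖ ^ q) atTop (nhds (‖f (u * z)‖ ^ q)) :=
    ((hP.tendsto_at hz).norm).rpow_const (Or.inr hq.le)
  have hs (t : ℝ) : circleMap 0 1 t ∈ Metric.closedBall (0 : ℂ) 1 :=
    Metric.sphere_subset_closedBall (circleMap_mem_sphere _ zero_le_one _)
  have hcont : ContinuousOn (fun z => f (u * z)) (Metric.closedBall 0 1) :=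
    hP.continuousOn (Frequently.of_forall fun n => (P n).continuous.continuousOn)
  obtain ⟨M, hM⟩ := (isCompact_closedBall (0 : ℂ) 1).exists_bound_of_continuousOn hcont
  have hK := continuous_poissonKernel_circleMap hw
  refine le_of_tendsto_of_tendsto' (hpt (Metric.ball_subset_closedBall hw)) ?_
    fun n => norm_eval_rpow_le_integral (P n) hq hw
  refine Tendsto.const_mul _ ?_
  -- Eventually `P n` is within `1` of the limit, whose norm is at most `M`; hence the dominating
  -- value `M + 1`.
  refine intervalIntegral.tendsto_integral_filter_of_dominated_convergence
    (fun t => poissonKernel 0 w (circleMap 0 1 t) * (M + 1) ^ q) ?_ ?_ ?_ ?_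
  · refine Eventually.of_forall fun n => Continuous.aestronglyMeasurable ?_
    have : Continuous fun t : ℝ => (P n).eval (circleMap 0 1 t) :=
      (P n).continuous.comp (continuous_circleMap 0 1)
    exact hK.mul (this.norm.rpow_const fun _ => Or.inr hq.le)
  · filter_upwards [Metric.tendstoUniformlyOn_iff.1 hP 1 one_pos] with n hn
    refine Eventually.of_forall fun t _ => ?_
    have h0 := poissonKernel_nonneg_of_mem hw (circleMap_mem_sphere (0 : ℂ) zero_le_one t)
    rw [Real.norm_of_nonneg (mul_nonneg h0 (by positivity))]
    gcongr
    have h1 := hn _ (hs t)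
    have h2 := hM _ (hs t)
    rw [dist_eq_norm] at h1
    have h3 := norm_sub_norm_le ((P n).eval (circleMap 0 1 t)) (f (u * circleMap 0 1 t))
    rw [norm_sub_rev] at h3
    linarith
  · exact (hK.mul continuous_const).intervalIntegrable _ _
  · exact Eventually.of_forall fun t _ => (hpt (hs t)).const_mul _

lemma enorm_rpow_le_lintegral_poissonKernel {f : ℂ → ℂ} (hf : AnalyticOnNhd ℂ f unitDisc)
    {u w : ℂ} (hu : ‖u‖ < 1) (hw : w ∈ Metric.ball (0 : ℂ) 1) {q : ℝ} (hq : 0 < q) :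
    ‖f (u * w)‖ₑ ^ q ≤ ∫⁻ t in Ioc (-Real.pi) Real.pi,
      ENNReal.ofReal (poissonKernel 0 w (circleMap 0 1 t)) * ‖f (u * circleMap 0 1 t)‖ₑ ^ q := by
  have hK := continuous_poissonKernel_circleMap hw
  have hmem (t : ℝ) : circleMap 0 1 t ∈ Metric.sphere (0 : ℂ) 1 :=
    circleMap_mem_sphere _ zero_le_one t
  have hfc : Continuous fun t : ℝ => f (u * circleMap 0 1 t) := by
    refine continuous_iff_continuousAt.2 fun t => ?_
    have h1 : ContinuousAt f (u * circleMap 0 1 t) := by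
      refine (hf _ ?_).continuousAt
      have := hmem t
      rw [mem_sphere_zero_iff_norm] at this
      rw [unitDisc, mem_ball_zero_iff, norm_mul, this, mul_one]
      exact hu
    exact h1.comp (f := fun t : ℝ => u * circleMap 0 1 t) (by fun_prop)
  set g : ℝ → ℝ := fun t => poissonKernel 0 w (circleMap 0 1 t) * ‖f (u * circleMap 0 1 t)‖ ^ q
  have hg0 (t : ℝ) : 0 ≤ g t := mul_nonneg (poissonKernel_nonneg_of_mem hw (hmem t)) (by positivity)
  have hgc : Continuous g := hK.mul (hfc.norm.rpow_const fun _ => Or.inr hq.le)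
  have hper : Function.Periodic g (2 * Real.pi) := fun t => by
    simp only [g, periodic_circleMap 0 1 t]
  have hshift := hper.intervalIntegral_add_eq 0 (-Real.pi)
  have e1 : (0 : ℝ) + 2 * Real.pi = 2 * Real.pi := by ring
  have e2 : -Real.pi + 2 * Real.pi = Real.pi := by ring
  rw [e1, e2] at hshift
  have hmain := norm_rpow_le_integral_poissonKernel hf hu hw hq
  have hle : ‖f (u * w)‖ ^ q ≤ ∫ t in Ioc (-Real.pi) Real.pi, g t := by
    rw [← intervalIntegral.integral_of_le (by linarith [Real.pi_pos]), ← hshift]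
    -- The factor `(2π)⁻¹ ≤ 1` is simply discarded.
    refine hmain.trans (mul_le_of_le_one_left ?_ ?_)
    · exact intervalIntegral.integral_nonneg Real.two_pi_pos.le fun t _ => hg0 t
    · exact inv_le_one_of_one_le₀ (by linarith [Real.pi_gt_three])
  have hint : IntegrableOn g (Ioc (-Real.pi) Real.pi) :=
    (hgc.integrableOn_Icc).mono_set Ioc_subset_Icc_self
  rw [← ofReal_norm, ENNReal.ofReal_rpow_of_nonneg (norm_nonneg _) hq.le]
  refine (ENNReal.ofReal_le_ofReal hle).trans_eq ?_
  rw [ofReal_integral_eq_lintegral_ofReal hint (Eventually.of_forall hg0)]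
  refine lintegral_congr fun t => ?_
  rw [← ofReal_norm, ENNReal.ofReal_rpow_of_nonneg (norm_nonneg _) hq.le,
    ENNReal.ofReal_mul (poissonKernel_nonneg_of_mem hw (hmem t))]

/-! ### The `TT*` argument for positive kernels -/

lemma lintegral_mul_sq_le {α : Type*} [MeasurableSpace α] {μ : Measure α} {f g : α → ℝ≥0∞}
    (hf : AEMeasurable f μ) (hg : AEMeasurable g μ) :
    (∫⁻ x, f x * g x ∂μ) ^ 2 ≤ (∫⁻ x, f x ^ 2 ∂μ) * ∫⁻ x, g x ^ 2 ∂μ := by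
  have h := ENNReal.lintegral_mul_le_Lp_mul_Lq μ Real.HolderConjugate.two_two hf hg
  have h2 := pow_le_pow_left' h 2
  simp only [Pi.mul_apply, ENNReal.rpow_two] at h2
  refine h2.trans_eq ?_
  rw [mul_pow, ← ENNReal.rpow_two, ← ENNReal.rpow_two, ← ENNReal.rpow_mul, ← ENNReal.rpow_mul]
  norm_num

/-- Finiteness permits the cancellation. The bounds `B` and `M` below serve only to supply it and do
not enter the constants. -/
lemma le_of_sq_le_mul {X Y : ℝ≥0∞} (hX : X ≠ ⊤) (h : X ^ 2 ≤ Y * X) : X ≤ Y := by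
  rcases eq_or_ne X 0 with rfl | h0
  · exact zero_le
  · rw [sq] at h
    exact (ENNReal.mul_le_mul_iff_left h0 hX).1 h

section TTStar

variable {α : Type*} [MeasurableSpace α] {μ : Measure α} [IsFiniteMeasure μ]
  {k : α → α → ℝ≥0∞} {B C M : ℝ≥0∞} {F : α → ℝ≥0∞}

lemma lintegral_ne_top_of_bounded (hM : M ≠ ⊤) (hF : ∀ x, F x ≤ M) : ∫⁻ x, F x ∂μ ≠ ⊤ := by
  refine ((lintegral_mono hF).trans_lt ?_).ne
  rw [lintegral_const]
  exact ENNReal.mul_lt_top hM.lt_top (measure_lt_top μ _)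

/-- `L²` bound for the adjoint of a positive kernel operator, from pointwise domination of the
product of two kernels. -/
lemma lintegral_adjoint_sq_le (hk : Measurable (Function.uncurry k)) (hB : B ≠ ⊤)
    (hkB : ∀ x t, k x t ≤ B) (hC : ∀ x, ∫⁻ t, k x t ∂μ ≤ C)
    (hkk : ∀ x y t, k x t * k y t ≤ 4 * (k x y * k y t + k y x * k x t))
    (hF : Measurable F) (hM : M ≠ ⊤) (hFM : ∀ x, F x ≤ M) :
    ∫⁻ t, (∫⁻ x, k x t * F x ∂μ) ^ 2 ∂μ ≤ (8 * C) ^ 2 * ∫⁻ x, F x ^ 2 ∂μ := by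
  have hk' {β : Type _} [MeasurableSpace β] {a b : β → α} (ha : Measurable a) (hb : Measurable b) :
      Measurable fun z => k (a z) (b z) := hk.comp (ha.prodMk hb)
  set S : α → ℝ≥0∞ := fun t => ∫⁻ x, k x t * F x ∂μ
  have hS : Measurable S :=
    Measurable.lintegral_prod_left' (f := fun z : α × α => k z.1 z.2 * F z.1)
      ((hk' measurable_fst measurable_snd).mul (hF.comp measurable_fst))
  have hSM (t : α) : S t ≤ B * M * μ univ := by
    rw [← lintegral_const]
    exact lintegral_mono fun x => mul_le_mul' (hkB x t) (hFM x)
  have hSM' : B * M * μ univ ≠ ⊤ :=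
    ENNReal.mul_ne_top (ENNReal.mul_ne_top hB hM) (measure_ne_top μ _)
  have hfin : ∫⁻ t, S t ^ 2 ∂μ ≠ ⊤ :=
    lintegral_ne_top_of_bounded (ENNReal.pow_ne_top hSM' (n := 2))
      fun t => pow_le_pow_left' (hSM t) 2
  have hFS : ∫⁻ p : α × α, k p.1 p.2 * (F p.1 * F p.2) ∂(μ.prod μ) = ∫⁻ y, F y * S y ∂μ := by
    rw [lintegral_prod_symm' (fun p : α × α => k p.1 p.2 * (F p.1 * F p.2)) (by fun_prop)]
    refine lintegral_congr fun y => ?_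
    simp only [S]
    rw [← lintegral_const_mul (F y) (f := fun x => k x y * F x) (by fun_prop)]
    exact lintegral_congr fun x => by ring
  have hFS' : ∫⁻ p : α × α, k p.2 p.1 * (F p.1 * F p.2) ∂(μ.prod μ) = ∫⁻ y, F y * S y ∂μ := by
    rw [lintegral_prod (fun p : α × α => k p.2 p.1 * (F p.1 * F p.2)) (by fun_prop)]
    refine lintegral_congr fun y => ?_
    simp only [S]
    rw [← lintegral_const_mul (F y) (f := fun x => k x y * F x) (by fun_prop)]
    exact lintegral_congr fun x => by ring
  -- Expand the square over pairs `(x, y)` and integrate in `t` first. By `hkk` each of the two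
  -- terms keeps one kernel to integrate in `t`, costing `C`, and leaves the pairing of `F` with
  -- `S`: in total `4C + 4C`. Only integrals in the second variable are bounded, so a Schur test is
  -- not available.
  have hmain : ∫⁻ t, S t ^ 2 ∂μ ≤ 8 * C * ∫⁻ y, F y * S y ∂μ := by
    have h1 (t : α) : S t ^ 2 =
        ∫⁻ p : α × α, (k p.1 t * F p.1) * (k p.2 t * F p.2) ∂(μ.prod μ) := by
      have hm : Measurable fun x => k x t * F x := (hk' measurable_id measurable_const).mul hF
      rw [lintegral_prod_mul hm.aemeasurable hm.aemeasurable, sq]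
    calc ∫⁻ t, S t ^ 2 ∂μ
        = ∫⁻ p : α × α, ∫⁻ t, (k p.1 t * F p.1) * (k p.2 t * F p.2) ∂μ ∂(μ.prod μ) := by
          simp_rw [h1]
          refine lintegral_lintegral_swap (Measurable.aemeasurable ?_)
          have m1 : Measurable fun z : α × α × α => z.2.1 := measurable_snd.fst
          have m2 : Measurable fun z : α × α × α => z.2.2 := measurable_snd.snd
          exact ((hk' m1 measurable_fst).mul (hF.comp m1)).mul
            ((hk' m2 measurable_fst).mul (hF.comp m2))
      _ ≤ ∫⁻ p : α × α, 4 * C * (k p.1 p.2 * (F p.1 * F p.2) + k p.2 p.1 * (F p.1 * F p.2))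
            ∂(μ.prod μ) := by
          refine lintegral_mono fun p => ?_
          have hm (x : α) : Measurable fun t => k x t := hk' measurable_const measurable_id
          calc ∫⁻ t, (k p.1 t * F p.1) * (k p.2 t * F p.2) ∂μ
              ≤ ∫⁻ t, (4 * F p.1 * F p.2) * (k p.1 p.2 * k p.2 t + k p.2 p.1 * k p.1 t) ∂μ := by
                refine lintegral_mono fun t => ?_
                calc (k p.1 t * F p.1) * (k p.2 t * F p.2)
                    = (k p.1 t * k p.2 t) * (F p.1 * F p.2) := by ring
                  _ ≤ (4 * (k p.1 p.2 * k p.2 t + k p.2 p.1 * k p.1 t)) * (F p.1 * F p.2) :=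
                      mul_le_mul_left (hkk _ _ _) _
                  _ = _ := by ring
            _ = (4 * F p.1 * F p.2) *
                (k p.1 p.2 * (∫⁻ t, k p.2 t ∂μ) + k p.2 p.1 * ∫⁻ t, k p.1 t ∂μ) := by
                rw [lintegral_const_mul _
                    (f := fun t => k p.1 p.2 * k p.2 t + k p.2 p.1 * k p.1 t) (by fun_prop),
                  lintegral_add_left (f := fun t => k p.1 p.2 * k p.2 t) (by fun_prop),
                  lintegral_const_mul _ (hm _), lintegral_const_mul _ (hm _)]
            _ ≤ (4 * F p.1 * F p.2) * (k p.1 p.2 * C + k p.2 p.1 * C) := by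
                gcongr <;> exact hC _
            _ = _ := by ring
      _ = 4 * C * ((∫⁻ y, F y * S y ∂μ) + ∫⁻ y, F y * S y ∂μ) := by
          rw [lintegral_const_mul _ (f := fun p : α × α =>
              k p.1 p.2 * (F p.1 * F p.2) + k p.2 p.1 * (F p.1 * F p.2)) (by fun_prop),
            lintegral_add_left (f := fun p : α × α => k p.1 p.2 * (F p.1 * F p.2)) (by fun_prop),
            hFS, hFS']
      _ = 8 * C * ∫⁻ y, F y * S y ∂μ := by ring
  refine le_of_sq_le_mul hfin ?_
  calc (∫⁻ t, S t ^ 2 ∂μ) ^ 2 ≤ (8 * C * ∫⁻ y, F y * S y ∂μ) ^ 2 := pow_le_pow_left' hmain 2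
    _ = (8 * C) ^ 2 * (∫⁻ y, F y * S y ∂μ) ^ 2 := mul_pow _ _ _
    _ ≤ (8 * C) ^ 2 * ((∫⁻ y, F y ^ 2 ∂μ) * ∫⁻ y, S y ^ 2 ∂μ) := by
        gcongr; exact lintegral_mul_sq_le hF.aemeasurable hS.aemeasurable
    _ = _ := by ring

/-- Duality: `‖TF‖² = ⟨F, T*(TF)⟩ ≤ ‖F‖ ‖T*(TF)‖`, with the adjoint bound applied to `TF`. -/
lemma lintegral_kernel_sq_le (hk : Measurable (Function.uncurry k)) (hB : B ≠ ⊤)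
    (hkB : ∀ x t, k x t ≤ B) (hC : ∀ x, ∫⁻ t, k x t ∂μ ≤ C)
    (hkk : ∀ x y t, k x t * k y t ≤ 4 * (k x y * k y t + k y x * k x t))
    (hF : Measurable F) (hM : M ≠ ⊤) (hFM : ∀ x, F x ≤ M) :
    ∫⁻ x, (∫⁻ t, k x t * F t ∂μ) ^ 2 ∂μ ≤ (8 * C) ^ 2 * ∫⁻ x, F x ^ 2 ∂μ := by
  have hk' {β : Type _} [MeasurableSpace β] {a b : β → α} (ha : Measurable a) (hb : Measurable b) :
      Measurable fun z => k (a z) (b z) := hk.comp (ha.prodMk hb)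
  set T : α → ℝ≥0∞ := fun x => ∫⁻ t, k x t * F t ∂μ
  have hT : Measurable T :=
    Measurable.lintegral_prod_right' (f := fun z : α × α => k z.1 z.2 * F z.2)
      ((hk' measurable_fst measurable_snd).mul (hF.comp measurable_snd))
  have hTM (x : α) : T x ≤ B * M * μ univ := by
    rw [← lintegral_const]
    exact lintegral_mono fun t => mul_le_mul' (hkB x t) (hFM t)
  have hTM' : B * M * μ univ ≠ ⊤ :=
    ENNReal.mul_ne_top (ENNReal.mul_ne_top hB hM) (measure_ne_top μ _)
  have hfin : ∫⁻ t, T t ^ 2 ∂μ ≠ ⊤ :=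
    lintegral_ne_top_of_bounded (ENNReal.pow_ne_top hTM' (n := 2))
      fun t => pow_le_pow_left' (hTM t) 2
  have hadj := lintegral_adjoint_sq_le hk hB hkB hC hkk hT hTM' hTM
  set S : α → ℝ≥0∞ := fun t => ∫⁻ x, k x t * T x ∂μ
  have hS : Measurable S :=
    Measurable.lintegral_prod_left' (f := fun z : α × α => k z.1 z.2 * T z.1)
      ((hk' measurable_fst measurable_snd).mul (hT.comp measurable_fst))
  have hdual : ∫⁻ x, T x ^ 2 ∂μ = ∫⁻ t, F t * S t ∂μ := by
    calc ∫⁻ x, T x ^ 2 ∂μ = ∫⁻ x, ∫⁻ t, T x * (k x t * F t) ∂μ ∂μ := by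
          refine lintegral_congr fun x => ?_
          rw [lintegral_const_mul (T x) (f := fun t => k x t * F t) (by fun_prop), sq]
      _ = ∫⁻ t, ∫⁻ x, T x * (k x t * F t) ∂μ ∂μ :=
          lintegral_lintegral_swap (((hT.comp measurable_fst).mul
            ((hk' measurable_fst measurable_snd).mul (hF.comp measurable_snd))).aemeasurable)
      _ = ∫⁻ t, F t * S t ∂μ := by
          refine lintegral_congr fun t => ?_
          simp only [S]
          rw [← lintegral_const_mul (F t) (f := fun x => k x t * T x) (by fun_prop)]
          exact lintegral_congr fun x => by ring
  refine le_of_sq_le_mul hfin ?_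
  calc (∫⁻ t, T t ^ 2 ∂μ) ^ 2 = (∫⁻ t, F t * S t ∂μ) ^ 2 := by rw [hdual]
    _ ≤ (∫⁻ t, F t ^ 2 ∂μ) * ∫⁻ t, S t ^ 2 ∂μ :=
        lintegral_mul_sq_le hF.aemeasurable hS.aemeasurable
    _ ≤ (∫⁻ t, F t ^ 2 ∂μ) * ((8 * C) ^ 2 * ∫⁻ x, T x ^ 2 ∂μ) := by gcongr
    _ = _ := by ring

end TTStar

/-! ### Cauchy kernels and their dyadic maximal function -/

/-- The Cauchy kernel of width `2 ^ (-n)` (up to the factor `π`). -/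
def cauchyKernel (n : ℕ) (s : ℝ) : ℝ≥0∞ :=
  ENNReal.ofReal ((1 / 2) ^ n / (((1 / 2) ^ n) ^ 2 + s ^ 2))

lemma measurable_cauchyKernel_comp {β : Type*} [MeasurableSpace β] {i : β → ℕ} {s : β → ℝ}
    (hi : Measurable i) (hs : Measurable s) : Measurable fun z => cauchyKernel (i z) (s z) := by
  have h : Measurable fun z => ((1 : ℝ) / 2) ^ i z :=
    (measurable_from_nat (f := fun n => ((1 : ℝ) / 2) ^ n)).comp hi
  exact (h.div ((h.pow_const 2).add (hs.pow_const 2))).ennreal_ofReal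

lemma cauchyKernel_neg (n : ℕ) (s : ℝ) : cauchyKernel n (-s) = cauchyKernel n s := by
  simp [cauchyKernel]

lemma cauchyKernel_le (n : ℕ) (s : ℝ) : cauchyKernel n s ≤ ENNReal.ofReal (2 ^ n) := by
  refine ENNReal.ofReal_le_ofReal ?_
  have h : (0 : ℝ) < (1 / 2) ^ n := by positivity
  have h2 : (2 : ℝ) ^ n * (1 / 2) ^ n = 1 := by rw [← mul_pow]; norm_num
  rw [div_le_iff₀ (by positivity)]
  nlinarith [mul_nonneg (by positivity : (0 : ℝ) ≤ 2 ^ n) (sq_nonneg s)]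

lemma lintegral_cauchyKernel (n : ℕ) (x : ℝ) :
    ∫⁻ t, cauchyKernel n (x - t) = ENNReal.ofReal Real.pi := by
  have h : (0 : ℝ) < (1 / 2) ^ n := by positivity
  set d : ℝ := (1 / 2) ^ n
  have e (s : ℝ) : d / (d ^ 2 + s ^ 2) = d⁻¹ * (1 + (s / d) ^ 2)⁻¹ := by field_simp
  rw [lintegral_sub_left_eq_self (fun s => cauchyKernel n s) x]
  have hi : Integrable fun s : ℝ => d / (d ^ 2 + s ^ 2) := by
    simp_rw [e]
    exact (integrable_inv_one_add_sq.comp_div h.ne').const_mul _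
  have hint : ∫ s : ℝ, d / (d ^ 2 + s ^ 2) = Real.pi := by
    simp_rw [e]
    rw [integral_const_mul, Measure.integral_comp_div (fun s : ℝ => (1 + s ^ 2)⁻¹),
      integral_univ_inv_one_add_sq, abs_of_pos h, smul_eq_mul, inv_mul_cancel_left₀ h.ne']
  rw [← hint, ofReal_integral_eq_lintegral_ofReal hi (Eventually.of_forall fun s => by positivity)]
  rfl

lemma cauchyKernel_le_four_mul (n : ℕ) {s r : ℝ} (h : |r| ≤ 2 * |s|) :
    cauchyKernel n s ≤ 4 * cauchyKernel n r := by
  have hd : (0 : ℝ) < (1 / 2) ^ n := by positivity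
  have h4 : (4 : ℝ≥0∞) = ENNReal.ofReal 4 := by norm_num
  rw [cauchyKernel, cauchyKernel, h4, ← ENNReal.ofReal_mul (by norm_num)]
  refine ENNReal.ofReal_le_ofReal ?_
  set d : ℝ := (1 / 2) ^ n
  have h2 : r ^ 2 ≤ 4 * s ^ 2 := by
    have := pow_le_pow_left₀ (abs_nonneg r) h 2
    rw [mul_pow, sq_abs, sq_abs] at this; linarith
  rw [← mul_div_assoc, div_le_div_iff₀ (by positivity) (by positivity)]
  nlinarith [sq_nonneg d]

/-- The distance `|x - y|` is at most twice the larger of `|x - t|` and `|y - t|`. The kernel at the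
farther point may therefore be evaluated at `x - y` instead, at the cost of a factor `4`. -/
lemma cauchyKernel_mul_le (m n : ℕ) (x y t : ℝ) :
    cauchyKernel m (x - t) * cauchyKernel n (y - t) ≤
      4 * (cauchyKernel m (x - y) * cauchyKernel n (y - t) +
        cauchyKernel n (y - x) * cauchyKernel m (x - t)) := by
  rw [mul_add]
  have htri : |x - y| ≤ |x - t| + |y - t| := by
    rw [abs_sub_comm y t]; exact abs_sub_le x t y
  rcases le_total |y - t| |x - t| with h | h
  · refine le_add_right ?_
    rw [← mul_assoc]
    exact mul_le_mul_left (cauchyKernel_le_four_mul m (by linarith)) _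
  · refine le_add_left ?_
    rw [← mul_assoc, mul_comm]
    exact mul_le_mul_left (cauchyKernel_le_four_mul n (by rw [abs_sub_comm y x]; linarith)) _

/-- The integral of `F` against the Cauchy kernel centred at `x`. -/
def cauchyMean (I : Set ℝ) (F : ℝ → ℝ≥0∞) (n : ℕ) (x : ℝ) : ℝ≥0∞ :=
  ∫⁻ t in I, cauchyKernel n (x - t) * F t

lemma measurable_cauchyMean (I : Set ℝ) {F : ℝ → ℝ≥0∞} (hF : Measurable F) (n : ℕ) :
    Measurable (cauchyMean I F n) :=
  Measurable.lintegral_prod_right' (f := fun z : ℝ × ℝ => cauchyKernel n (z.1 - z.2) * F z.2)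
    ((measurable_cauchyKernel_comp measurable_const (measurable_fst.sub measurable_snd)).mul
      (hF.comp measurable_snd))

/-- This linearizes the maximal function: a truncated supremum becomes a single operator whose index
depends measurably on `x`. -/
lemma exists_measurable_argmax {α : Type*} [MeasurableSpace α] {T : ℕ → α → ℝ≥0∞}
    (hT : ∀ n, Measurable (T n)) (n : ℕ) :
    ∃ i : α → ℕ, Measurable i ∧ (∀ x, i x ≤ n) ∧
      ∀ x, partialSups (fun m => T m x) n = T (i x) x := by
  induction n with
  | zero => exact ⟨fun _ => 0, measurable_const, by simp, by simp⟩
  | succ n ih =>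
    obtain ⟨i, hi, hin, hiT⟩ := ih
    have hTi : Measurable fun x => T (i x) x := by
      have h : Measurable fun z : ℕ × α => T z.1 z.2 :=
        measurable_from_prod_countable_right fun n => hT n
      exact h.comp (hi.prodMk measurable_id)
    classical
    refine ⟨fun x => if T (i x) x ≤ T (n + 1) x then n + 1 else i x,
      Measurable.ite (measurableSet_le hTi (hT _)) measurable_const hi, fun x => ?_, fun x => ?_⟩
    · dsimp only
      split_ifs
      · exact le_rfl
      · exact (hin x).trans n.le_succ
    · rw [partialSups_add_one, hiT]
      dsimp only
      split_ifs with h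
      · exact sup_eq_right.2 h
      · exact sup_eq_left.2 (not_le.1 h).le

/-- The `L²` maximal inequality for the dyadic Cauchy means. -/
lemma lintegral_iSup_cauchyMean_sq_le {I : Set ℝ} (hI : volume I ≠ ⊤) {F : ℝ → ℝ≥0∞}
    (hF : Measurable F) {M : ℝ≥0∞} (hM : M ≠ ⊤) (hFM : ∀ x, F x ≤ M) :
    ∫⁻ x in I, (⨆ n, cauchyMean I F n x) ^ 2 ≤
      (8 * ENNReal.ofReal Real.pi) ^ 2 * ∫⁻ x in I, F x ^ 2 := by
  have : IsFiniteMeasure (volume.restrict I) := ⟨by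
    rw [Measure.restrict_apply_univ]; exact hI.lt_top⟩
  have hT := measurable_cauchyMean I hF
  have hsup (x : ℝ) : (⨆ n, cauchyMean I F n x) ^ 2 =
      ⨆ n, (partialSups (fun m => cauchyMean I F m x) n) ^ 2 := by
    rw [← iSup_partialSups_eq, ENNReal.iSup_pow]
  simp_rw [hsup]
  have hexists (n : ℕ) := exists_measurable_argmax hT n
  have hmeas (n : ℕ) : Measurable fun x => partialSups (fun m => cauchyMean I F m x) n := by
    induction n with
    | zero => simpa using hT 0
    | succ n ih => simp_rw [partialSups_add_one]; exact ih.sup (hT _)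
  -- Monotone convergence reduces to finitely many widths, provided the bound does not depend on
  -- `n`.
  rw [lintegral_iSup (fun n => (hmeas n).pow_const 2)
    (fun m n hmn x => pow_le_pow_left' ((partialSups _).monotone hmn) 2)]
  refine iSup_le fun n => ?_
  obtain ⟨i, hi, hin, hiT⟩ := hexists n
  simp_rw [hiT]
  -- The bound `2 ^ n` on the kernel is only qualitative; the constant comes from `C = π`, the mass
  -- of every Cauchy kernel.
  refine lintegral_kernel_sq_le (μ := volume.restrict I)
    (k := fun x t => cauchyKernel (i x) (x - t)) (B := ENNReal.ofReal (2 ^ n)) ?_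
    ENNReal.ofReal_ne_top (fun x t => ?_) (fun x => ?_) (fun x y t => cauchyKernel_mul_le _ _ _ _ _)
    hF hM hFM
  · exact measurable_cauchyKernel_comp (hi.comp measurable_fst)
      (measurable_fst.sub measurable_snd)
  · exact (cauchyKernel_le _ _).trans (ENNReal.ofReal_le_ofReal
      (pow_le_pow_right₀ one_le_two (hin x)))
  · exact (setLIntegral_le_lintegral _ _).trans_eq (lintegral_cauchyKernel _ _)

/-! ### The nontangential maximal theorem on circles -/

/-- In the approach region with vertex `1`, the Poisson kernel is dominated by a Cauchy kernel
centred at the vertex. -/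
lemma poissonKernel_le_of_mem_approach {v : ℂ} (hv : |v.arg| < (1 / 2) * (1 - ‖v‖)) :
    ∃ n : ℕ, ∀ t ∈ Ioc (-Real.pi) Real.pi,
      ENNReal.ofReal (poissonKernel 0 v (circleMap 0 1 t)) ≤ 40 * cauchyKernel n t := by
  have hδ : 0 < 1 - ‖v‖ := by linarith [abs_nonneg v.arg]
  -- With `d = 2 ^ (-n)` this gives `d / 2 < 1 - ‖v‖ ≤ d`.
  obtain ⟨n, hn1, hn2⟩ := exists_nat_pow_near_of_lt_one (y := (1 / 2 : ℝ)) hδ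
    (by linarith [norm_nonneg v]) (by norm_num) (by norm_num)
  refine ⟨n, fun t ht => ?_⟩
  have hd : (0 : ℝ) < (1 / 2) ^ n := by positivity
  have h40 : (40 : ℝ≥0∞) = ENNReal.ofReal 40 := by norm_num
  rw [cauchyKernel, h40, ← ENNReal.ofReal_mul (by norm_num)]
  refine ENNReal.ofReal_le_ofReal ?_
  rw [pow_succ] at hn1
  set d : ℝ := (1 / 2) ^ n
  have hcirc (s : ℝ) : circleMap 0 1 s = Complex.exp (Complex.I * s) := by
    simp [circleMap, mul_comm]
  have hnorm (s : ℝ) : ‖circleMap 0 1 s‖ = 1 := by simp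
  rw [poissonKernel_def]
  simp only [sub_zero, hnorm]
  set D : ℝ := ‖circleMap 0 1 t - v‖
  have hD1 : 1 - ‖v‖ ≤ D := by
    have := norm_sub_norm_le (circleMap 0 1 t) v
    rwa [hnorm] at this
  -- Radial distance `1 - ‖v‖` to the circle, plus an arc of length less than half of that.
  have hv1 : ‖v - 1‖ ≤ (3 / 2) * (1 - ‖v‖) := by
    have e1 : v - circleMap 0 1 v.arg = ((‖v‖ - 1 : ℝ) : ℂ) * circleMap 0 1 v.arg := by
      have : v = ‖v‖ * circleMap 0 1 v.arg := by
        rw [hcirc, mul_comm Complex.I]; exact (Complex.norm_mul_exp_arg_mul_I v).symm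
      calc v - circleMap 0 1 v.arg = ‖v‖ * circleMap 0 1 v.arg - circleMap 0 1 v.arg := by
            rw [← this]
        _ = _ := by push_cast; ring
    have e2 : ‖v - circleMap 0 1 v.arg‖ = 1 - ‖v‖ := by
      rw [e1, norm_mul, hnorm, mul_one, Complex.norm_real, Real.norm_eq_abs,
        abs_of_neg (by linarith)]
      ring
    have e3 : ‖circleMap 0 1 v.arg - 1‖ ≤ |v.arg| := by
      rw [hcirc]; exact Real.norm_exp_I_mul_ofReal_sub_one_le
    have := norm_sub_le_norm_sub_add_norm_sub v (circleMap 0 1 v.arg) 1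
    linarith
  have ht1 : 2 / Real.pi * |t| ≤ ‖circleMap 0 1 t - 1‖ := by
    rw [hcirc, Complex.norm_exp_I_mul_ofReal_sub_one, norm_mul, Real.norm_eq_abs, Real.norm_eq_abs,
      abs_two]
    have habs : |t| ≤ Real.pi := abs_le.2 ⟨ht.1.le, ht.2⟩
    have h2 : |t / 2| = |t| / 2 := by rw [abs_div, abs_two]
    have := Real.mul_abs_le_abs_sin (x := t / 2) (by rw [h2]; linarith)
    rw [h2] at this
    linarith
  -- From `(2 / π) |t| ≤ D + (3 / 2) D`, since `5π / 4 < 4`.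
  have hD2 : |t| ≤ 4 * D := by
    have h1 := norm_sub_le_norm_sub_add_norm_sub (circleMap 0 1 t) v 1
    have h2 : 2 / Real.pi * |t| ≤ (5 / 2) * D := by
      have : D = ‖circleMap 0 1 t - v‖ := rfl
      linarith
    rw [div_mul_eq_mul_div, div_le_iff₀ Real.pi_pos] at h2
    have hD0 : 0 ≤ D := norm_nonneg _
    nlinarith [Real.pi_lt_d2]
  have hD0 : 0 < D := by linarith
  -- Here `20 = 2² + 4²`; the numerator below contributes the remaining factor `2` of `40`.
  have hsum : d ^ 2 + t ^ 2 ≤ 20 * D ^ 2 := by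
    have h1 : t ^ 2 ≤ (4 * D) ^ 2 := by
      rw [← sq_abs t]; exact pow_le_pow_left₀ (abs_nonneg t) hD2 2
    have h2 : d ^ 2 ≤ (2 * D) ^ 2 := pow_le_pow_left₀ hd.le (by linarith) 2
    nlinarith
  rw [← mul_div_assoc, div_le_div_iff₀ (by positivity) (by positivity)]
  have hnum : 1 ^ 2 - ‖v‖ ^ 2 ≤ 2 * d := by nlinarith [norm_nonneg v]
  calc (1 ^ 2 - ‖v‖ ^ 2) * (d ^ 2 + t ^ 2) ≤ (2 * d) * (20 * D ^ 2) := by gcongr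
    _ = 40 * d * D ^ 2 := by ring

lemma mul_circleMap_add (z : ℂ) (s t : ℝ) :
    z * circleMap 0 1 s * circleMap 0 1 t = z * circleMap 0 1 (s + t) := by
  simp [circleMap, mul_assoc, ← Complex.exp_add, add_mul]

section Circle

variable {f : ℂ → ℂ} {z : ℂ} {q : ℝ}

lemma continuous_comp_mul_circleMap (hf : AnalyticOnNhd ℂ f unitDisc) (hz : z ∈ unitDisc) :
    Continuous fun t : ℝ => f (z * circleMap 0 1 t) := by
  refine continuous_iff_continuousAt.2 fun t => ?_
  have h1 : ContinuousAt f (z * circleMap 0 1 t) := by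
    refine (hf _ ?_).continuousAt
    rw [unitDisc, mem_ball_zero_iff] at hz ⊢
    simpa using hz
  exact h1.comp (f := fun t : ℝ => z * circleMap 0 1 t) (by fun_prop)

/-- Dividing by `u` moves the vertex to `1`, where the kernel comparison applies. As `θ` and `t`
both lie in `(-π, π]`, their sum stays in `(-2π, 2π]`; integrating over this longer interval avoids
wrapping angles. -/
lemma nonTangentialMax_rpow_le (hf : AnalyticOnNhd ℂ f unitDisc) (hz : z ∈ unitDisc) (hz0 : z ≠ 0)
    (hq : 0 < q) {θ : ℝ} (hθ : θ ∈ Ioc (-Real.pi) Real.pi) :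
    nonTangentialMax f (z * circleMap 0 1 θ) ^ q ≤
      40 * ⨆ n, cauchyMean (Ioc (-(2 * Real.pi)) (2 * Real.pi))
        (fun s => ‖f (z * circleMap 0 1 s)‖ₑ ^ q) n θ := by
  set G : ℝ → ℝ≥0∞ := fun s => ‖f (z * circleMap 0 1 s)‖ₑ ^ q
  set u : ℂ := z * circleMap 0 1 θ with hu
  have hu0 : u ≠ 0 := mul_ne_zero hz0 (circleMap_ne_center one_ne_zero)
  have hu1 : ‖u‖ < 1 := by
    rw [unitDisc, mem_ball_zero_iff] at hz
    simpa [hu] using hz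
  rw [← ENNReal.le_rpow_inv_iff hq]
  refine iSup₂_le fun w hw => ?_
  rw [ENNReal.le_rpow_inv_iff hq]
  have hwu : u * (w / u) = w := mul_div_cancel₀ w hu0
  have hv : |(w / u).arg| < (1 / 2) * (1 - ‖w / u‖) := by rw [norm_div]; exact hw.2
  have hv1 : w / u ∈ Metric.ball (0 : ℂ) 1 := by
    rw [mem_ball_zero_iff]; linarith [abs_nonneg (w / u).arg]
  obtain ⟨n, hn⟩ := poissonKernel_le_of_mem_approach hv
  have hP := enorm_rpow_le_lintegral_poissonKernel hf hu1 hv1 hq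
  rw [hwu] at hP
  calc ‖f w‖ₑ ^ q ≤ _ := hP
    _ ≤ ∫⁻ t in Ioc (-Real.pi) Real.pi, 40 * (cauchyKernel n (θ - (θ + t)) * G (θ + t)) := by
        refine setLIntegral_mono' measurableSet_Ioc fun t ht => ?_
        rw [sub_add_cancel_left, cauchyKernel_neg, ← mul_assoc]
        simp only [hu, mul_circleMap_add, G]
        exact mul_le_mul_left (hn t ht) _
    _ = 40 * ∫⁻ t in Ioc (-Real.pi) Real.pi, cauchyKernel n (θ - (θ + t)) * G (θ + t) :=
        lintegral_const_mul' _ _ (by norm_num)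
    _ = 40 * ∫⁻ s in Ioc (θ + -Real.pi) (θ + Real.pi), cauchyKernel n (θ - s) * G s := by
        rw [← (measurePreserving_add_left volume θ).setLIntegral_comp_preimage_emb
          (measurableEmbedding_addLeft θ) (fun s => cauchyKernel n (θ - s) * G s)]
        simp
    _ ≤ 40 * ⨆ n, cauchyMean (Ioc (-(2 * Real.pi)) (2 * Real.pi)) G n θ := by
        gcongr
        refine le_iSup_of_le n (lintegral_mono_set (Ioc_subset_Ioc ?_ ?_))
        · linarith [hθ.1]
        · linarith [hθ.2]

/-- The constant in the nontangential maximal theorem on circles. -/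
def maximalConst : ℝ≥0 := 40 ^ 2 * (8 * Real.toNNReal Real.pi) ^ 2

lemma lintegral_nonTangentialMax_le (hf : AnalyticOnNhd ℂ f unitDisc) (hz : z ∈ unitDisc)
    (hz0 : z ≠ 0) {p : ℝ} (hp : 0 < p) :
    ∫⁻ θ in Ioc (-Real.pi) Real.pi, nonTangentialMax f (z * circleMap 0 1 θ) ^ p ≤
      maximalConst * ∫⁻ θ in Ioc (-(2 * Real.pi)) (2 * Real.pi),
        ‖f (z * circleMap 0 1 θ)‖ₑ ^ p := by
  have hq : 0 < p / 2 := half_pos hp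
  have hsq (x : ℝ≥0∞) : x ^ p = (x ^ (p / 2)) ^ 2 := by
    rw [← ENNReal.rpow_two, ← ENNReal.rpow_mul]; congr 1; ring
  have hfc := continuous_comp_mul_circleMap hf hz
  set G : ℝ → ℝ≥0∞ := fun s => ‖f (z * circleMap 0 1 s)‖ₑ ^ (p / 2)
  have hG : Measurable G := (hfc.enorm.measurable).pow_const _
  -- Only the existence of `M` matters: it supplies the boundedness required by the maximal
  -- inequality.
  obtain ⟨M, hM⟩ : ∃ M : ℝ, ∀ w ∈ Metric.closedBall (0 : ℂ) ‖z‖, ‖f w‖ ≤ M := by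
    refine (isCompact_closedBall (0 : ℂ) ‖z‖).exists_bound_of_continuousOn
      (hf.continuousOn.mono (Metric.closedBall_subset_ball ?_))
    rwa [unitDisc, mem_ball_zero_iff] at hz
  have hGM (s : ℝ) : G s ≤ ENNReal.ofReal M ^ (p / 2) := by
    refine ENNReal.rpow_le_rpow ?_ hq.le
    rw [← ofReal_norm]
    exact ENNReal.ofReal_le_ofReal (hM _ (by simp))
  have hI : volume (Ioc (-(2 * Real.pi)) (2 * Real.pi)) ≠ ⊤ := by simp
  have hmax := lintegral_iSup_cauchyMean_sq_le hI hG
    (ENNReal.rpow_ne_top_of_nonneg hq.le ENNReal.ofReal_ne_top) hGM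
  calc ∫⁻ θ in Ioc (-Real.pi) Real.pi, nonTangentialMax f (z * circleMap 0 1 θ) ^ p
      ≤ ∫⁻ θ in Ioc (-Real.pi) Real.pi,
          40 ^ 2 * (⨆ n, cauchyMean (Ioc (-(2 * Real.pi)) (2 * Real.pi)) G n θ) ^ 2 := by
        refine setLIntegral_mono' measurableSet_Ioc fun θ hθ => ?_
        rw [hsq, ← mul_pow]
        exact pow_le_pow_left' (nonTangentialMax_rpow_le hf hz hz0 hq hθ) 2
    _ ≤ ∫⁻ θ in Ioc (-(2 * Real.pi)) (2 * Real.pi),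
          40 ^ 2 * (⨆ n, cauchyMean (Ioc (-(2 * Real.pi)) (2 * Real.pi)) G n θ) ^ 2 :=
        lintegral_mono_set (Ioc_subset_Ioc (by linarith [Real.pi_pos]) (by linarith [Real.pi_pos]))
    _ = 40 ^ 2 * ∫⁻ θ in Ioc (-(2 * Real.pi)) (2 * Real.pi),
          (⨆ n, cauchyMean (Ioc (-(2 * Real.pi)) (2 * Real.pi)) G n θ) ^ 2 :=
        lintegral_const_mul' _ _ (by norm_num)
    _ ≤ 40 ^ 2 * ((8 * ENNReal.ofReal Real.pi) ^ 2 *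
          ∫⁻ θ in Ioc (-(2 * Real.pi)) (2 * Real.pi), G θ ^ 2) := by gcongr
    _ = _ := by
        simp_rw [hsq, ← mul_assoc]
        congr 1

end Circle

/-! ### Averaging over rotations -/

section Rotation

lemma measurePreserving_mul_circleMap (θ : ℝ) :
    MeasurePreserving (fun z : ℂ => z * circleMap 0 1 θ) areaMeasure areaMeasure := by
  have h := ((rotation (Circle.exp θ)).measurePreserving).smul_measure (ENNReal.ofReal Real.pi)⁻¹
  have heq : (fun z : ℂ => z * circleMap 0 1 θ) = rotation (Circle.exp θ) := by
    ext z
    simp [rotation_apply, circleMap, mul_comm]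
  rw [heq]
  exact h

lemma measurableEmbedding_mul_circleMap (θ : ℝ) :
    MeasurableEmbedding (fun z : ℂ => z * circleMap 0 1 θ) := by
  convert (rotation (Circle.exp θ)).toHomeomorph.measurableEmbedding using 1
  ext z
  simp [rotation_apply, circleMap, mul_comm]

variable {ω : ℂ → ℝ}

lemma setLIntegral_rotation (hω : IsRadialWeight ω) (F : ℂ → ℝ≥0∞) (θ : ℝ) :
    ∫⁻ z in unitDisc, F (z * circleMap 0 1 θ) * ENNReal.ofReal (ω z) ∂areaMeasure =
      ∫⁻ z in unitDisc, F z * ENNReal.ofReal (ω z) ∂areaMeasure := by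
  have hnorm (z : ℂ) : ‖z * circleMap 0 1 θ‖ = ‖z‖ := by simp
  have hmem (z : ℂ) : z * circleMap 0 1 θ ∈ unitDisc ↔ z ∈ unitDisc := by
    rw [unitDisc, mem_ball_zero_iff, mem_ball_zero_iff, hnorm]
  have hpre : (fun z : ℂ => z * circleMap 0 1 θ) ⁻¹' unitDisc = unitDisc := by
    ext z; exact hmem z
  rw [← (measurePreserving_mul_circleMap θ).setLIntegral_comp_preimage_emb
    (measurableEmbedding_mul_circleMap θ) (fun z => F z * ENNReal.ofReal (ω z)) unitDisc, hpre]
  refine setLIntegral_congr_fun Metric.isOpen_ball.measurableSet fun z hz => ?_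
  rw [hω.radial z hz, hω.radial _ ((hmem z).2 hz), hnorm]

instance : SFinite areaMeasure := by unfold areaMeasure; infer_instance

/-- Tonelli and rotation invariance of `ω dA`. This replaces polar coordinates in passing from
circles to the disc. -/
lemma setLIntegral_average_rotation (hω : IsRadialWeight ω) {F : ℂ → ℝ≥0∞} (hF : Measurable F)
    (K : Set ℝ) :
    ∫⁻ z in unitDisc, (∫⁻ θ in K, F (z * circleMap 0 1 θ)) * ENNReal.ofReal (ω z) ∂areaMeasure =
      volume K * ∫⁻ z in unitDisc, F z * ENNReal.ofReal (ω z) ∂areaMeasure := by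
  have hm : Measurable fun x : ℂ × ℝ => F (x.1 * circleMap 0 1 x.2) :=
    hF.comp (by fun_prop)
  have hωm : AEMeasurable (fun z => ENNReal.ofReal (ω z)) (areaMeasure.restrict unitDisc) :=
    hω.integrableOn.aestronglyMeasurable.aemeasurable.ennreal_ofReal
  calc _ = ∫⁻ z in unitDisc, (∫⁻ θ in K, F (z * circleMap 0 1 θ) * ENNReal.ofReal (ω z))
        ∂areaMeasure := by
        refine lintegral_congr fun z => ?_
        rw [lintegral_mul_const' _ _ ENNReal.ofReal_ne_top]
    _ = ∫⁻ θ in K, (∫⁻ z in unitDisc, F (z * circleMap 0 1 θ) * ENNReal.ofReal (ω z)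
        ∂areaMeasure) :=
        lintegral_lintegral_swap (hm.aemeasurable.mul hωm.comp_fst)
    _ = _ := by
        simp_rw [setLIntegral_rotation hω]
        rw [lintegral_const, Measure.restrict_apply_univ, mul_comm]

end Rotation

/-! ### The two norm inequalities -/

/-- The vertex is not in its approach region, the inequality there being strict, but `t * u` is for
`0 < t < 1`; let `t` tend to `1`. -/
lemma enorm_le_nonTangentialMax {f : ℂ → ℂ} {u : ℂ} (hf : ContinuousAt f u) (hu : u ∈ unitDisc)
    (hu0 : u ≠ 0) : ‖f u‖ₑ ≤ nonTangentialMax f u := by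
  have hcont : ContinuousAt (fun t : ℝ => ‖f (t * u)‖ₑ) 1 := by
    have h1 : ContinuousAt f (((1 : ℝ) : ℂ) * u) := by simpa using hf
    exact (h1.comp (f := fun t : ℝ => (t : ℂ) * u) (by fun_prop)).enorm
  have htend : Tendsto (fun t : ℝ => ‖f (t * u)‖ₑ) (nhdsWithin 1 (Iio 1)) (nhds ‖f u‖ₑ) := by
    have := hcont.tendsto.mono_left (nhdsWithin_le_nhds (s := Iio 1))
    simpa using this
  refine le_of_tendsto htend ?_
  filter_upwards [Ioo_mem_nhdsLT (zero_lt_one (α := ℝ))] with t ht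
  have hn : ‖(t : ℂ) * u‖ = t * ‖u‖ := by
    rw [norm_mul, Complex.norm_real, Real.norm_of_nonneg ht.1.le]
  refine le_iSup₂_of_le (t * u) ⟨?_, ?_⟩ le_rfl
  · rw [unitDisc, mem_ball_zero_iff] at hu ⊢
    rw [hn]
    nlinarith [norm_nonneg u, ht.1, ht.2]
  · rw [mul_div_cancel_right₀ _ hu0, Complex.arg_ofReal_of_nonneg ht.1.le, abs_zero, hn,
      mul_div_cancel_right₀ _ (norm_ne_zero_iff.2 hu0)]
    linarith [ht.2]

lemma ae_areaMeasure_ne_zero : ∀ᵐ z ∂areaMeasure.restrict unitDisc, z ≠ 0 := by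
  refine ae_restrict_of_ae ?_
  rw [ae_iff]
  simp [areaMeasure]

lemma bergmanPow_le_nonTangentialMax {p : ℝ} (hp : 0 < p) (ω : ℂ → ℝ) {f : ℂ → ℂ}
    (hf : AnalyticOnNhd ℂ f unitDisc) :
    bergmanPow p ω f ≤ weightedLpPow p ω (nonTangentialMax f) := by
  refine lintegral_mono_ae ?_
  filter_upwards [ae_areaMeasure_ne_zero, ae_restrict_mem Metric.isOpen_ball.measurableSet]
    with z hz0 hz
  gcongr
  exact enorm_le_nonTangentialMax (hf z hz).continuousAt hz hz0

lemma nonTangentialMax_le_bergmanPow {p : ℝ} (hp : 0 < p) {ω : ℂ → ℝ} (hω : IsRadialWeight ω)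
    {f : ℂ → ℂ} (hf : AnalyticOnNhd ℂ f unitDisc) :
    weightedLpPow p ω (nonTangentialMax f) ≤
      ((2 * maximalConst : ℝ≥0) : ℝ≥0∞) * bergmanPow p ω f := by
  have hD : MeasurableSet unitDisc := Metric.isOpen_ball.measurableSet
  -- Outside the disc `f` is arbitrary; the cut-off makes the integrand measurable on all of `ℂ`.
  set F : ℂ → ℝ≥0∞ := unitDisc.indicator fun z => ‖f z‖ₑ ^ p
  have hF : Measurable F := by
    classical
    have h : ContinuousOn (fun z => ‖f z‖ₑ ^ p) unitDisc :=
      ENNReal.continuous_rpow_const.comp_continuousOn hf.continuousOn.enorm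
    simp only [F, ← piecewise_eq_indicator]
    exact h.measurable_piecewise continuousOn_const hD
  have hFz {z : ℂ} (hz : z ∈ unitDisc) (θ : ℝ) :
      F (z * circleMap 0 1 θ) = ‖f (z * circleMap 0 1 θ)‖ₑ ^ p := by
    refine indicator_of_mem ?_ _
    rw [unitDisc, mem_ball_zero_iff] at hz ⊢
    simpa using hz
  have hN := setLIntegral_average_rotation hω
    ((measurable_nonTangentialMax f).pow_const p) (Ioc (-Real.pi) Real.pi)
  have hf' := setLIntegral_average_rotation hω hF (Ioc (-(2 * Real.pi)) (2 * Real.pi))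
  have hFint : ∫⁻ z in unitDisc, F z * ENNReal.ofReal (ω z) ∂areaMeasure = bergmanPow p ω f :=
    setLIntegral_congr_fun hD fun z hz => by
      simp only [F, indicator_of_mem hz]
  rw [hFint] at hf'
  have hle : volume (Ioc (-Real.pi) Real.pi) * weightedLpPow p ω (nonTangentialMax f) ≤
      maximalConst * (volume (Ioc (-(2 * Real.pi)) (2 * Real.pi)) * bergmanPow p ω f) := by
    rw [← hf', weightedLpPow, ← hN, ← lintegral_const_mul' _ _ ENNReal.coe_ne_top]
    refine lintegral_mono_ae ?_
    filter_upwards [ae_areaMeasure_ne_zero, ae_restrict_mem hD] with z hz0 hz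
    rw [← mul_assoc]
    refine mul_le_mul_left ?_ _
    simp_rw [hFz hz]
    exact lintegral_nonTangentialMax_le hf hz hz0 hp
  -- The longer interval covers the circle twice, hence the factor `2` in the constant.
  have hv : volume (Ioc (-(2 * Real.pi)) (2 * Real.pi)) = 2 * volume (Ioc (-Real.pi) Real.pi) := by
    rw [Real.volume_Ioc, Real.volume_Ioc, ← ENNReal.ofReal_ofNat 2,
      ← ENNReal.ofReal_mul (by norm_num)]
    congr 1; ring
  have hv0 : volume (Ioc (-Real.pi) Real.pi) ≠ 0 := by simp [Real.pi_pos]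
  have hvt : volume (Ioc (-Real.pi) Real.pi) ≠ ⊤ := by simp
  rw [hv] at hle
  refine (ENNReal.mul_le_mul_iff_right hv0 hvt).1 (hle.trans_eq ?_)
  push_cast
  ring
end

theorem lemma3p3 (p : ℝ) (hp : 0 < p) (ω : ℂ → ℝ) (hω : IsRadialWeight ω) :
    ∃ C : ℝ≥0, 0 < C ∧ ∀ f : ℂ → ℂ, AnalyticOnNhd ℂ f unitDisc →
      bergmanPow p ω f ≤ weightedLpPow p ω (nonTangentialMax f) ∧
      weightedLpPow p ω (nonTangentialMax f) ≤ (C : ℝ≥0∞) * bergmanPow p ω f := by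
  refine ⟨2 * maximalConst, ?_, fun f hf =>
    ⟨bergmanPow_le_nonTangentialMax hp ω hf, nonTangentialMax_le_bergmanPow hp hω hf⟩⟩
  have : 0 < Real.toNNReal Real.pi := Real.toNNReal_pos.2 Real.pi_pos
  unfold maximalConst
  positivity
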